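/- Let $\mathcal U$ be a universe of $m$ IDs. An input is a finite sequence of updates $S=(i_1,d_1),\dots,(i_t,d_t)\in(\mathcal U\times\mathbb Z)^t$, either with all $d_k\ge 0$ (cash register model) or with arbitrary $d_k$ (turnstile model). Its state vector is $a[i]=\sum_{k:\,i_k=i}d_k$, and its distinct count is $D(S)=|\{i\in\mathcal U: a[i]\ne 0\}|$. Two inputs $S,S'$ are neighbors if there are IDs $i\neq j$, a set $K$ of indices of updates of $i$ in $S$ and a set $K'$ of indices of updates of $j$ in $S'$ such that $\sum_{k\in K}d_k=\sum_{k\in K'}d'_k$ and, for every ID, the updates of $S$ outside $K$ and those of $S'$ outside $K'$ have the same total. An online algorithm on $\mathcal U$ has an arbitrary (measurable) set of internal states, a random initial state, a randomized transition of the state for each arriving update, and a randomized real output computed from the current state. It is $\varepsilon$-pan-private (against a single intrusion) if for all neighboring inputs $S,S'$ of the model and all measurable sets $I'$ of states and $\sigma'$ of outputs, $\Pr[(\text{state},\text{output})(S)\in I'\times\sigma']\le e^{\varepsilon}\,\Pr[(\text{state},\text{output})(S')\in I'\times\sigma']$. Let $\rho^*=\Pr[|Z|>\sqrt{2\ln 2}]\approx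 0.239$, where $Z$ is a standard Gaussian. **Statement.** Fix either of the two input models. Let $\eta\ge 0$ and $\delta<\rho^*/(6(1+\eta))$ be constants, let $\alpha(m)=o(\sqrt m)$, and let $\varepsilon$ be any constant. Then for all sufficiently large $m$, no online algorithm on a universe of $m$ IDs which on every input $S$ of the model outputs a value in $[D(S)-\alpha(m),\,D(S)+\alpha(m)]$ with probability at least $1-\delta$ is $\varepsilon$-pan-private for that model. -/

import Mathlib

open MeasureTheory ProbabilityTheory Filter Asymptotics

universe u

namespace PanPrivacy

/-- An update `(i, d)`: the count of the ID `i` changes by the integer `d`. -/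
abbrev Update (U : Type*) := U × ℤ

/-- The two input models: in the cash register model all updates satisfy `d ≥ 0`,
in the turnstile model updates are arbitrary. -/
inductive StreamModel where
  | cashRegister
  | turnstile

/-- `M.Admissible S`: the finite sequence of updates `S` is an input of the model `M`. -/
def StreamModel.Admissible {U : Type*} : StreamModel → List (Update U) → Prop
  | .cashRegister, S => ∀ x ∈ S, 0 ≤ x.2
  | .turnstile, _ => True

/-- The `i`-th coordinate of the state vector of `S`: the sum of all `d_k` with `i_k = i`. -/
def stateVector {U : Type*} [DecidableEq U] (S : List (Update U)) (i : U) : ℤ :=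
  ∑ k : Fin S.length with (S.get k).1 = i, (S.get k).2

/-- The distinct count `D(S)`: the number of IDs whose state vector entry is nonzero. -/
def distinctCount {U : Type*} [Fintype U] [DecidableEq U] (S : List (Update U)) : ℕ :=
  Finset.card {i : U | stateVector S i ≠ 0}

/-- User-level neighbours: some of the updates of one ID `i` in `S` (those indexed by `K`) are
replaced in `S'` by updates of another ID `j` (those indexed by `K'`) with the same total, and the
remaining updates of `S` and of `S'` have the same total for every ID. The order of the updates,
their number, and the way in which totals are broken up may differ. -/
def Neighbors {U : Type*} [DecidableEq U] (S S' : List (Update U)) : Prop :=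
  ∃ i j : U, i ≠ j ∧ ∃ (K : Finset (Fin S.length)) (K' : Finset (Fin S'.length)),
    (∀ k ∈ K, (S.get k).1 = i) ∧
    (∀ k ∈ K', (S'.get k).1 = j) ∧
    ∑ k ∈ K, (S.get k).2 = ∑ k ∈ K', (S'.get k).2 ∧
    ∀ l : U, ∑ k ∈ Kᶜ with (S.get k).1 = l, (S.get k).2 =
      ∑ k ∈ K'ᶜ with (S'.get k).1 = l, (S'.get k).2

/-- A randomized online algorithm over the ID universe `U`, with an arbitrary (possibly infinite)
set of internal states: a random initial state, a randomized transition of the state for each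
arriving update, and a randomized real-valued output computed from the current state. -/
structure OnlineAlgorithm (U : Type*) where
  State : Type u
  [measurableSpaceState : MeasurableSpace State]
  init : Measure State
  [isProbabilityMeasure_init : IsProbabilityMeasure init]
  step : Update U → Kernel State State
  [isMarkovKernel_step : ∀ x, IsMarkovKernel (step x)]
  output : Kernel State ℝ
  [isMarkovKernel_output : IsMarkovKernel output]

attribute [instance] OnlineAlgorithm.measurableSpaceState
  OnlineAlgorithm.isProbabilityMeasure_init OnlineAlgorithm.isMarkovKernel_step
  OnlineAlgorithm.isMarkovKernel_output

namespace OnlineAlgorithm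

variable {U : Type*}

/-- The law of the internal state after the updates `S` have been processed in order. -/
noncomputable def stateLaw (A : OnlineAlgorithm.{u} U) (S : List (Update U)) : Measure A.State :=
  S.foldl (fun μ x => μ.bind (A.step x)) A.init

/-- The joint law of the pair (internal state, output) on input `S`. -/
noncomputable def law (A : OnlineAlgorithm.{u} U) (S : List (Update U)) : Measure (A.State × ℝ) :=
  (A.stateLaw S) ⊗ₘ A.output

/-- On every input `S` of the model, the output is `D(S) ± α` with probability at least
`1 - δ`. -/
def EstimatesDistinctCount [Fintype U] [DecidableEq U] (A : OnlineAlgorithm.{u} U)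
    (M : StreamModel) (α δ : ℝ) : Prop :=
  ∀ S : List (Update U), M.Admissible S →
    1 - δ ≤ (A.law S).real {p | |p.2 - (distinctCount S : ℝ)| ≤ α}

/-- User-level `ε`-pan-privacy against a single intrusion: the joint law of the internal state and
the output changes by a factor of at most `exp ε` between neighbouring inputs of the model. -/
def PanPrivate [DecidableEq U] (A : OnlineAlgorithm.{u} U) (M : StreamModel) (ε : ℝ) : Prop :=
  ∀ S S' : List (Update U), M.Admissible S → M.Admissible S' → Neighbors S S' →
    ∀ (I' : Set A.State) (σ' : Set ℝ), MeasurableSet I' → MeasurableSet σ' →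
      A.law S (I' ×ˢ σ') ≤ ENNReal.ofReal (Real.exp ε) * A.law S' (I' ×ˢ σ')

end OnlineAlgorithm

/-- The critical error rate `ρ* ≈ 0.239` of linear programming decoding: `ρ* = P(|Z| > c)` for a
standard Gaussian `Z`, where `c` is the point with `E[|Z|; |Z| > c] = E[|Z|; |Z| ≤ c]`. Since
`E[|Z|; |Z| > c] = exp (-c ^ 2 / 2) * E|Z|`, this point is `c = √(2 log 2)`. -/
noncomputable def rhoStar : ℝ :=
  (gaussianReal 0 1).real {z | √(2 * Real.log 2) < |z|}

end PanPrivacy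

/-!
For bit vectors `z` and `q` of length `n`, insert for every position one of two IDs, first as
prescribed by `z` and then as prescribed by `q`: the distinct count is `n` plus the Hamming
distance of `z` and `q`. With probability bounded below, the internal state after the insertion of
`z` answers clearly more than half of the queries `q` with error at most `a`. If the same state
does so for `y` as well, then the distances of `z` and of `y` to `q` differ by at most `2 * a` for
a positive fraction of all `q`. By anticoncentration of sums of signs, this forces `z` and `y` to
be at Hamming distance `O(a ^ 2) = o(n)`. So a decoder that sees only the state returns `z` up to
`o(n)` wrong bits, with probability bounded below. This contradicts privacy: flipping one bit of
`z` yields a neighboring input, so that a bit is decoded wrongly almost as often, up to a factor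
`exp ε`, as it is decoded correctly.
-/

namespace PanPrivacy

section Counting

lemma centralBinom_sq_mul_le (m : ℕ) : m.centralBinom ^ 2 * (2 * m + 1) ≤ 16 ^ m := by
  induction m with
  | zero => simp
  | succ m ih =>
    have hodd : (2 * m + 1) * (2 * m + 3) ≤ 4 * (m + 1) ^ 2 := by nlinarith
    refine Nat.le_of_mul_le_mul_left ?_ (by positivity : 0 < (m + 1) ^ 2)
    calc (m + 1) ^ 2 * ((m + 1).centralBinom ^ 2 * (2 * (m + 1) + 1))
        = ((m + 1) * (m + 1).centralBinom) ^ 2 * (2 * m + 3) := by ring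
      _ = 4 * ((2 * m + 1) * (2 * m + 3)) * (m.centralBinom ^ 2 * (2 * m + 1)) := by
          rw [Nat.succ_mul_centralBinom_succ]; ring
      _ ≤ 4 * (4 * (m + 1) ^ 2) * 16 ^ m := Nat.mul_le_mul (Nat.mul_le_mul_left 4 hodd) ih
      _ = (m + 1) ^ 2 * 16 ^ (m + 1) := by ring

lemma choose_sq_mul_succ_le (k j : ℕ) : k.choose j ^ 2 * (k + 1) ≤ 4 ^ k := by
  have hmid : k.choose j ^ 2 * (k + 1) ≤ k.choose (k / 2) ^ 2 * (k + 1) := by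
    gcongr; exact Nat.choose_le_middle j k
  refine hmid.trans ?_
  obtain ⟨m, rfl | rfl⟩ := k.even_or_odd'
  · rw [Nat.mul_div_cancel_left m two_pos, pow_mul]
    exact centralBinom_sq_mul_le m
  · have hcentral : (m + 1).centralBinom = 2 * (2 * m + 1).choose m := by
      rw [Nat.centralBinom_eq_two_mul_choose, mul_add_one, Nat.choose_succ_succ',
        Nat.choose_symm_half, ← two_mul]
    have hbound := centralBinom_sq_mul_le (m + 1)
    have hpow : 4 * 4 ^ (2 * m + 1) = 16 ^ (m + 1) := by
      rw [← pow_succ', show 2 * m + 1 + 1 = 2 * (m + 1) by ring, pow_mul]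
      norm_num
    rw [hcentral] at hbound
    rw [show (2 * m + 1) / 2 = m by omega]
    nlinarith

lemma card_filter_abs_two_mul_sub_le (k : ℕ) {r : ℝ} (hr : 0 ≤ r) :
    (({j ∈ Finset.range (k + 1) | |2 * (j : ℝ) - k| ≤ 2 * r} : Finset ℕ).card : ℝ) ≤ 2 * r + 1 := by
  have hsub : ({j ∈ Finset.range (k + 1) | |2 * (j : ℝ) - k| ≤ 2 * r} : Finset ℕ) ⊆
      Finset.Icc ⌈(k : ℝ) / 2 - r⌉₊ ⌊(k : ℝ) / 2 + r⌋₊ := by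
    intro j hj
    have habs := abs_le.1 (Finset.mem_filter.1 hj).2
    exact Finset.mem_Icc.2 ⟨Nat.ceil_le.2 (by linarith), Nat.le_floor (by linarith)⟩
  refine (Nat.cast_le.2 ((Finset.card_le_card hsub).trans_eq (Nat.card_Icc _ _))).trans ?_
  have hceil := Nat.le_ceil ((k : ℝ) / 2 - r)
  have hfloor := Nat.floor_le (by positivity : 0 ≤ (k : ℝ) / 2 + r)
  rcases le_total ⌈(k : ℝ) / 2 - r⌉₊ (⌊(k : ℝ) / 2 + r⌋₊ + 1) with h | h
  · rw [Nat.cast_sub h]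
    push_cast
    linarith
  · rw [Nat.sub_eq_zero_of_le h]
    push_cast
    positivity

end Counting

section Hypercube

variable {ι : Type*}

lemma hammingDist_sub_hammingDist [Fintype ι] (z y q : ι → Bool) :
    (hammingDist z q : ℝ) - hammingDist y q =
      2 * (Finset.card {i ∈ ({i | z i ≠ y i} : Finset ι) | z i ≠ q i} : ℝ) - hammingDist z y := by
  simp only [hammingDist, Finset.filter_filter, Finset.card_filter, Nat.cast_sum, Finset.mul_sum,
    ← Finset.sum_sub_distrib]
  refine Finset.sum_congr rfl fun i _ => ?_
  cases z i <;> cases y i <;> cases q i <;> norm_num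

lemma card_filter_eq_or_eq [Fintype ι] (z q : ι → Bool) :
    Finset.card {p : ι × Bool | z p.1 = p.2 ∨ q p.1 = p.2} =
      Fintype.card ι + hammingDist z q := by
  have hbit : ∀ a b : Bool, (∑ c, if a = c ∨ b = c then 1 else 0) = 1 + if a ≠ b then 1 else 0 := by
    decide
  simp only [Finset.card_filter, Fintype.sum_prod_type, hbit, Finset.sum_add_distrib, hammingDist]
  simp

/-- The bit vector `z` with the bit `i` flipped; the inputs encoding `z` and `flipBit z i` are the
neighbors on which privacy is used. -/
def flipBit [DecidableEq ι] (z : ι → Bool) (i : ι) : ι → Bool :=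
  Function.update z i (!z i)

lemma flipBit_involutive [DecidableEq ι] (i : ι) :
    Function.Involutive fun z : ι → Bool => flipBit z i :=
  fun z => by simp [flipBit]

variable [Fintype ι] [DecidableEq ι]

lemma card_filter_card_ne_eq_le (T : Finset ι) (z : ι → Bool) (j : ℕ) :
    Finset.card {q : ι → Bool | Finset.card {i ∈ T | z i ≠ q i} = j} ≤
      T.card.choose j * 2 ^ Tᶜ.card := by
  rw [← Finset.card_powersetCard, ← Finset.card_powerset, ← Finset.card_product]
  refine Finset.card_le_card_of_injOn
    (fun q => ({i ∈ T | z i ≠ q i}, {i ∈ Tᶜ | z i ≠ q i})) (fun q hq => ?_) fun q _ q' _ h => ?_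
  · exact Finset.mem_product.2 ⟨Finset.mem_powersetCard.2
      ⟨Finset.filter_subset _ _, (Finset.mem_filter.1 hq).2⟩,
      Finset.mem_powerset.2 (Finset.filter_subset _ _)⟩
  · funext i
    have hT := Finset.ext_iff.1 (congrArg Prod.fst h) i
    have hTc := Finset.ext_iff.1 (congrArg Prod.snd h) i
    simp only [Finset.mem_filter, Finset.mem_compl] at hT hTc
    by_cases hi : i ∈ T <;> cases hz : z i <;> cases hq : q i <;> cases hq' : q' i <;> simp_all

/-- Over the bits where `z` and `y` differ, the difference of the distances is a sum of independent
signs, and each of its values is taken with at most the central binomial probability. -/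
lemma card_abs_hammingDist_sub_le_sq_mul_le (z y : ι → Bool) {r : ℝ} (hr : 0 ≤ r) :
    (Finset.card {q : ι → Bool | |(hammingDist z q : ℝ) - hammingDist y q| ≤ 2 * r} : ℝ) ^ 2 *
      (hammingDist z y + 1) ≤ ((2 * r + 1) * 2 ^ Fintype.card ι) ^ 2 := by
  set T : Finset ι := {i | z i ≠ y i}
  set k := hammingDist z y
  have hk : k = T.card := rfl
  set J : Finset ℕ := {j ∈ Finset.range (k + 1) | |2 * (j : ℝ) - k| ≤ 2 * r}
  set Q : Finset (ι → Bool) := {q | |(hammingDist z q : ℝ) - hammingDist y q| ≤ 2 * r}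
  have hmaps : ∀ q ∈ Q, Finset.card {i ∈ T | z i ≠ q i} ∈ J := fun q hq => by
    have hq := (Finset.mem_filter.1 hq).2
    rw [hammingDist_sub_hammingDist] at hq
    exact Finset.mem_filter.2
      ⟨Finset.mem_range_succ_iff.2 (Finset.card_le_card (Finset.filter_subset _ T)), hq⟩
  have hfiber : ∀ j ∈ J, Finset.card {q ∈ Q | Finset.card {i ∈ T | z i ≠ q i} = j} ≤
      k.choose (k / 2) * 2 ^ Tᶜ.card := fun j _ =>
    (Finset.card_le_card (Finset.filter_subset_filter _ (Finset.subset_univ _))).trans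
      ((card_filter_card_ne_eq_le T z j).trans (by gcongr; exact Nat.choose_le_middle j k))
  have hQ : (Q.card : ℝ) ≤ (2 * r + 1) * (k.choose (k / 2) * 2 ^ Tᶜ.card) := by
    have hcard := Finset.card_le_mul_card_image_of_maps_to hmaps _ hfiber
    calc (Q.card : ℝ) ≤ k.choose (k / 2) * 2 ^ Tᶜ.card * J.card := by exact_mod_cast hcard
      _ ≤ k.choose (k / 2) * 2 ^ Tᶜ.card * (2 * r + 1) := by
          gcongr; exact card_filter_abs_two_mul_sub_le k hr
      _ = _ := by ring
  have hchoose : (k.choose (k / 2) : ℝ) ^ 2 * (k + 1) ≤ 4 ^ k := by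
    exact_mod_cast choose_sq_mul_succ_le k (k / 2)
  have hfour : (4 : ℝ) ^ k = (2 ^ k) ^ 2 := by rw [pow_right_comm]; norm_num
  calc (Q.card : ℝ) ^ 2 * (k + 1)
      ≤ ((2 * r + 1) * (k.choose (k / 2) * 2 ^ Tᶜ.card)) ^ 2 * (k + 1) := by gcongr
    _ = (2 * r + 1) ^ 2 * (2 ^ Tᶜ.card) ^ 2 * ((k.choose (k / 2)) ^ 2 * (k + 1)) := by ring
    _ ≤ (2 * r + 1) ^ 2 * (2 ^ Tᶜ.card) ^ 2 * 4 ^ k := by gcongr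
    _ = ((2 * r + 1) * 2 ^ Fintype.card ι) ^ 2 := by
        rw [← Finset.card_add_card_compl T, ← hk, pow_add, hfour]; ring

lemma hammingDist_flipBit_le (z y : ι → Bool) (i : ι) :
    hammingDist (flipBit z i) y ≤ hammingDist z y + 1 := by
  have hone : hammingDist z (flipBit z i) ≤ 1 := by
    refine (Finset.card_le_card (t := {i}) fun j hj => ?_).trans_eq (Finset.card_singleton i)
    by_contra hji
    exact (Finset.mem_filter.1 hj).2
      (Function.update_of_ne (Finset.mem_singleton.not.1 hji) _ z).symm
  have := hammingDist_triangle_left (flipBit z i) y z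
  omega

lemma sum_sum_ball_ne_le {f : (ι → Bool) → ℝ} (hf : ∀ z, 0 ≤ f z) (y : ι → Bool) {K : ℝ}
    (hK : 0 ≤ K) :
    ∑ i, ∑ z with (hammingDist z y : ℝ) ≤ K ∧ z i ≠ y i, f z ≤ K * ∑ z, f z := by
  simp only [Finset.sum_filter]
  rw [Finset.sum_comm, Finset.mul_sum]
  refine Finset.sum_le_sum fun z _ => ?_
  by_cases hz : (hammingDist z y : ℝ) ≤ K
  · simp only [hz, true_and, ← Finset.sum_filter, Finset.sum_const, nsmul_eq_mul]
    exact mul_le_mul_of_nonneg_right hz (hf z)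
  · simpa [hz] using mul_nonneg hK (hf z)

/-- Flipping the bit `i` maps the ball around `y` into the next larger one and turns agreement with
`y` at `i` into disagreement. -/
lemma sum_ball_le_mul_sum_ball_ne {f : (ι → Bool) → ℝ} {C : ℝ} (hC : 0 ≤ C) (hf : ∀ z, 0 ≤ f z)
    (i : ι) (hflip : ∀ z, f z ≤ C * f (flipBit z i)) (y : ι → Bool) (K : ℝ) :
    ∑ z with (hammingDist z y : ℝ) + 1 ≤ K, f z ≤
      (C + 1) * ∑ z with (hammingDist z y : ℝ) ≤ K ∧ z i ≠ y i, f z := by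
  simp only [Finset.sum_filter]
  set g : (ι → Bool) → ℝ := fun z => if (hammingDist z y : ℝ) ≤ K ∧ z i ≠ y i then f z else 0
  have hg : ∀ z, 0 ≤ g z := fun z => by dsimp only [g]; split_ifs <;> simp [hf]
  have hsum_flip : ∑ z, g (flipBit z i) = ∑ z, g z :=
    Equiv.sum_comp (flipBit_involutive i).toPerm g
  calc ∑ z, (if (hammingDist z y : ℝ) + 1 ≤ K then f z else 0)
      ≤ ∑ z, (C * g (flipBit z i) + g z) := Finset.sum_le_sum fun z _ => ?_
    _ = (C + 1) * ∑ z, g z := by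
        rw [Finset.sum_add_distrib, ← Finset.mul_sum, hsum_flip]; ring
  split_ifs with hball
  · by_cases hzi : z i = y i
    · have hdist : (hammingDist (flipBit z i) y : ℝ) ≤ K :=
        le_trans (by exact_mod_cast hammingDist_flipBit_le z y i) hball
      have hgflip : g (flipBit z i) = f (flipBit z i) := if_pos ⟨hdist, by simp [flipBit, hzi]⟩
      rw [hgflip]
      linarith [hflip z, hg z]
    · have hgz : g z = f z := if_pos ⟨by linarith, hzi⟩
      linarith [mul_nonneg hC (hg (flipBit z i))]
  · linarith [mul_nonneg hC (hg (flipBit z i)), hg z]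

lemma card_mul_sum_ball_le {f : (ι → Bool) → ℝ} {C K : ℝ} (hC : 0 ≤ C) (hK : 0 ≤ K)
    (hf : ∀ z, 0 ≤ f z) (hflip : ∀ z i, f z ≤ C * f (flipBit z i)) (y : ι → Bool) :
    Fintype.card ι * ∑ z with (hammingDist z y : ℝ) + 1 ≤ K, f z ≤ (C + 1) * K * ∑ z, f z := by
  calc Fintype.card ι * ∑ z with (hammingDist z y : ℝ) + 1 ≤ K, f z
      = ∑ _i : ι, ∑ z with (hammingDist z y : ℝ) + 1 ≤ K, f z := by simp
    _ ≤ ∑ i, (C + 1) * ∑ z with (hammingDist z y : ℝ) ≤ K ∧ z i ≠ y i, f z :=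
        Finset.sum_le_sum fun i _ => sum_ball_le_mul_sum_ball_ne hC hf i (hflip · i) y K
    _ ≤ (C + 1) * (K * ∑ z, f z) := by
        rw [← Finset.mul_sum]
        gcongr
        exact sum_sum_ball_ne_le hf y hK
    _ = (C + 1) * K * ∑ z, f z := by ring

/-- Here `P z y` is the probability that the decoder returns `y` on the database `z`. -/
lemma mul_card_le_of_le_sum_ball {P : (ι → Bool) → (ι → Bool) → ℝ} {C K p : ℝ} (hC : 0 ≤ C)
    (hK : 0 ≤ K) (hP : ∀ z y, 0 ≤ P z y) (hsum : ∀ z, ∑ y, P z y ≤ 1)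
    (hflip : ∀ z i y, P z y ≤ C * P (flipBit z i) y)
    (hball : ∀ z, p ≤ ∑ y with (hammingDist z y : ℝ) + 1 ≤ K, P z y) :
    p * Fintype.card ι ≤ (C + 1) * K := by
  have hcube : (0 : ℝ) < Fintype.card (ι → Bool) := by exact_mod_cast Fintype.card_pos
  refine le_of_mul_le_mul_left ?_ hcube
  calc (Fintype.card (ι → Bool) : ℝ) * (p * Fintype.card ι)
      = Fintype.card ι * ∑ _z : ι → Bool, p := by
        rw [Finset.sum_const, Finset.card_univ, nsmul_eq_mul]; ring
    _ ≤ Fintype.card ι * ∑ z, ∑ y with (hammingDist z y : ℝ) + 1 ≤ K, P z y := by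
        gcongr with z; exact hball z
    _ = ∑ y, Fintype.card ι * ∑ z with (hammingDist z y : ℝ) + 1 ≤ K, P z y := by
        simp only [Finset.sum_filter, ← Finset.mul_sum]
        rw [Finset.sum_comm]
    _ ≤ ∑ y, (C + 1) * K * ∑ z, P z y := Finset.sum_le_sum fun y _ =>
        card_mul_sum_ball_le hC hK (hP · y) (fun z i => hflip z i y) y
    _ = (C + 1) * K * ∑ z, ∑ y, P z y := by rw [← Finset.mul_sum, Finset.sum_comm]
    _ ≤ (C + 1) * K * ∑ _z : ι → Bool, 1 := by gcongr with z; exact hsum z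
    _ = Fintype.card (ι → Bool) * ((C + 1) * K) := by
        rw [Finset.sum_const, Finset.card_univ, nsmul_eq_mul]; ring

end Hypercube

section Decoding

variable {Ω : Type*} [MeasurableSpace Ω]

lemma integral_measureReal_eq_comp {β : Type*} [MeasurableSpace β] (κ : Kernel Ω β)
    [IsFiniteKernel κ] (μ : Measure Ω) {B : Set β} (hB : MeasurableSet B) :
    ∫ s, (κ s).real B ∂μ = (κ ∘ₘ μ).real B := by
  rw [measureReal_def, Measure.bind_apply hB κ.aemeasurable, ← integral_toReal
    (κ.measurable_coe hB).aemeasurable (ae_of_all _ fun s => measure_lt_top (κ s) B)]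
  rfl

/-- Measurability of the choice is free because the choice only depends on the finitely many truth
values `s ∈ A z`. -/
lemma exists_measurable_mem_of_exists_mem {Z : Type*} [Finite Z] [Nonempty Z] [MeasurableSpace Z]
    {A : Z → Set Ω} (hA : ∀ z, MeasurableSet (A z)) :
    ∃ D : Ω → Z, Measurable D ∧ ∀ z, ∀ s ∈ A z, s ∈ A (D s) := by
  have hmem : Measurable fun s z => s ∈ A z :=
    measurable_pi_lambda _ fun z => measurableSet_setOfPred.1 (hA z)
  exact ⟨fun s => Classical.epsilon fun z => s ∈ A z,
    (Measurable.of_discrete (f := Classical.epsilon)).comp hmem,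
    fun z s hs => Classical.epsilon_spec (p := fun z => s ∈ A z) ⟨z, hs⟩⟩

variable {Q β : Type*} [Fintype Q] [PseudoMetricSpace β] [MeasurableSpace β]
  (F : Q → Kernel Ω β)

/-- The expected number of queries `q` that the state `s` answers with an error of more than `a`,
when the answer is drawn from `F q s` and the correct one is `c q`. -/
noncomputable def expectedErrors (c : Q → β) (a : ℝ) (s : Ω) : ℝ :=
  ∑ q, (F q s).real (Metric.closedBall (c q) a)ᶜ

lemma card_lt_dist_le_expectedErrors_add [∀ q, IsMarkovKernel (F q)] (c c' : Q → β) (a : ℝ)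
    (s : Ω) :
    (Finset.card {q | 2 * a < dist (c q) (c' q)} : ℝ) ≤
      expectedErrors F c a s + expectedErrors F c' a s := by
  rw [Finset.natCast_card_filter, expectedErrors, expectedErrors, ← Finset.sum_add_distrib]
  refine Finset.sum_le_sum fun q _ => ?_
  split_ifs with hq
  · have hdisj := Metric.closedBall_disjoint_closedBall (by linarith : a + a < dist (c q) (c' q))
    calc (1 : ℝ) = (F q s).real ((Metric.closedBall (c q) a)ᶜ ∪ (Metric.closedBall (c' q) a)ᶜ) := by
          rw [← Set.compl_inter, hdisj.inter_eq, Set.compl_empty, probReal_univ]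
      _ ≤ _ := measureReal_union_le _ _
  · positivity

variable [OpensMeasurableSpace β]

lemma measurable_expectedErrors (c : Q → β) (a : ℝ) : Measurable (expectedErrors F c a) :=
  Finset.measurable_sum _ fun q _ =>
    ((F q).measurable_coe measurableSet_closedBall.compl).ennreal_toReal

variable [∀ q, IsMarkovKernel (F q)]

lemma integral_expectedErrors_le {μ : Measure Ω} [IsProbabilityMeasure μ] {c : Q → β} {a δ : ℝ}
    (hacc : ∀ q, 1 - δ ≤ (F q ∘ₘ μ).real (Metric.closedBall (c q) a)) :
    ∫ s, expectedErrors F c a s ∂μ ≤ δ * Fintype.card Q := by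
  have hquery : ∀ q, ∫ s, (F q s).real (Metric.closedBall (c q) a)ᶜ ∂μ ≤ δ := fun q => by
    rw [integral_measureReal_eq_comp (F q) μ measurableSet_closedBall.compl,
      probReal_compl_eq_one_sub measurableSet_closedBall]
    linarith [hacc q]
  unfold expectedErrors
  rw [integral_finsetSum _ fun q _ =>
    Kernel.IsMarkovKernel.integrable μ (F q) measurableSet_closedBall.compl]
  calc _ ≤ ∑ _q : Q, δ := Finset.sum_le_sum fun q _ => hquery q
    _ = δ * Fintype.card Q := by simp [mul_comm]

lemma one_sub_div_le_measureReal_expectedErrors_le [Nonempty Q] {μ : Measure Ω}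
    [IsProbabilityMeasure μ] {c : Q → β} {a δ θ : ℝ} (hθ : 0 < θ)
    (hacc : ∀ q, 1 - δ ≤ (F q ∘ₘ μ).real (Metric.closedBall (c q) a)) :
    1 - δ / θ ≤ μ.real {s | expectedErrors F c a s ≤ θ * Fintype.card Q} := by
  set t : ℝ := θ * Fintype.card Q
  have hcard : (0 : ℝ) < Fintype.card Q := by exact_mod_cast Fintype.card_pos
  have hmarkov : t * μ.real {s | t ≤ expectedErrors F c a s} ≤ δ * Fintype.card Q :=
    (mul_meas_ge_le_integral_of_nonneg
      (ae_of_all _ fun s => Finset.sum_nonneg fun _ _ => measureReal_nonneg)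
      (integrable_finsetSum _ fun q _ =>
        Kernel.IsMarkovKernel.integrable μ (F q) measurableSet_closedBall.compl) t).trans
      (integral_expectedErrors_le F hacc)
  have hbad : μ.real {s | expectedErrors F c a s ≤ t}ᶜ ≤ δ / θ := by
    calc μ.real {s | expectedErrors F c a s ≤ t}ᶜ
        ≤ μ.real {s | t ≤ expectedErrors F c a s} :=
          measureReal_mono fun s (hs : ¬ _ ≤ t) => (not_le.1 hs).le
      _ ≤ δ / θ := by
          rw [le_div_iff₀ hθ]
          refine le_of_mul_le_mul_right ?_ hcard
          linarith
  rw [probReal_compl_eq_one_sub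
    (measurableSet_le (measurable_expectedErrors F c a) measurable_const)] at hbad
  linarith

end Decoding

section Reconstruction

variable {Ω ι : Type*} [MeasurableSpace Ω] [Fintype ι] [DecidableEq ι]
  (F : (ι → Bool) → Kernel Ω ℝ) [∀ q, IsMarkovKernel (F q)] {a b δ θ : ℝ}

lemma hammingDist_add_one_le_of_expectedErrors_le (ha : 0 ≤ a) (hθ : θ < 1 / 2) {z y : ι → Bool}
    {s : Ω} (hz : expectedErrors F (fun q => b + hammingDist z q) a s ≤
      θ * Fintype.card (ι → Bool))
    (hy : expectedErrors F (fun q => b + hammingDist y q) a s ≤ θ * Fintype.card (ι → Bool)) :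
    (hammingDist z y : ℝ) + 1 ≤ ((2 * a + 1) / (1 - 2 * θ)) ^ 2 := by
  set N : ℝ := 2 ^ Fintype.card ι
  have hcard : (Fintype.card (ι → Bool) : ℝ) = N := by simp [N]
  set Q : Finset (ι → Bool) := {q | |(hammingDist z q : ℝ) - hammingDist y q| ≤ 2 * a}
  have hfar : (Qᶜ.card : ℝ) ≤ 2 * θ * N := by
    have := card_lt_dist_le_expectedErrors_add F (fun q => b + hammingDist z q)
      (fun q => b + hammingDist y q) a s
    simp only [dist_add_left, Real.dist_eq] at this
    rw [hcard] at hz hy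
    simp only [Q, Finset.compl_filter, not_le]
    linarith
  have hnear : (1 - 2 * θ) * N ≤ Q.card := by
    have : (Q.card : ℝ) + Qᶜ.card = N := by
      rw [← hcard]; exact_mod_cast Finset.card_add_card_compl Q
    linarith
  have hgap : 0 < 1 - 2 * θ := by linarith
  rw [div_pow, le_div_iff₀ (by positivity)]
  refine le_of_mul_le_mul_left ?_ (by positivity : 0 < N ^ 2)
  calc N ^ 2 * ((hammingDist z y + 1) * (1 - 2 * θ) ^ 2)
      = ((1 - 2 * θ) * N) ^ 2 * (hammingDist z y + 1) := by ring
    _ ≤ (Q.card : ℝ) ^ 2 * (hammingDist z y + 1) := by gcongr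
    _ ≤ ((2 * a + 1) * N) ^ 2 := card_abs_hammingDist_sub_le_sq_mul_le z y ha
    _ = N ^ 2 * (2 * a + 1) ^ 2 := by ring

lemma exists_decoder (b : ℝ) (ha : 0 ≤ a) (hθ : θ < 1 / 2) :
    ∃ D : Ω → ι → Bool, Measurable D ∧
      ∀ z s, expectedErrors F (fun q => b + hammingDist z q) a s ≤ θ * Fintype.card (ι → Bool) →
        (hammingDist z (D s) : ℝ) + 1 ≤ ((2 * a + 1) / (1 - 2 * θ)) ^ 2 := by
  obtain ⟨D, hD, hmem⟩ := exists_measurable_mem_of_exists_mem fun z : ι → Bool =>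
    measurableSet_le (measurable_expectedErrors F (fun q => b + hammingDist z q) a)
      (measurable_const (a := θ * Fintype.card (ι → Bool)))
  exact ⟨D, hD, fun z s hs =>
    hammingDist_add_one_le_of_expectedErrors_le F ha hθ hs (hmem z s hs)⟩

theorem mul_card_le_of_accurate_of_private {μ : (ι → Bool) → Measure Ω}
    [∀ z, IsProbabilityMeasure (μ z)] {C : ℝ} (hC : 0 ≤ C) (ha : 0 ≤ a) (hθ₀ : 0 < θ)
    (hθ : θ < 1 / 2)
    (hacc : ∀ z q, 1 - δ ≤ (F q ∘ₘ μ z).real (Metric.closedBall (b + hammingDist z q) a))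
    (hpriv : ∀ z i I, MeasurableSet I → (μ z).real I ≤ C * (μ (flipBit z i)).real I) :
    (1 - δ / θ) * Fintype.card ι ≤ (C + 1) * ((2 * a + 1) / (1 - 2 * θ)) ^ 2 := by
  obtain ⟨D, hD, hdist⟩ := exists_decoder F b ha hθ
  have hfiber : ∀ y, MeasurableSet (D ⁻¹' {y}) := fun y => hD (measurableSet_singleton y)
  have hsum : ∀ z (S : Finset (ι → Bool)),
      ∑ y ∈ S, (μ z).real (D ⁻¹' {y}) = (μ z).real (D ⁻¹' S) := fun z S =>
    sum_measureReal_preimage_singleton S fun y _ => hfiber y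
  refine mul_card_le_of_le_sum_ball (P := fun z y => (μ z).real (D ⁻¹' {y})) hC (sq_nonneg _)
    (fun z y => measureReal_nonneg) (fun z => ?_) (fun z i y => hpriv z i _ (hfiber y)) fun z => ?_
  · rw [hsum]
    exact measureReal_le_one
  · rw [hsum]
    refine (one_sub_div_le_measureReal_expectedErrors_le F hθ₀ (hacc z)).trans
      (measureReal_mono fun s hs => ?_)
    simpa using hdist z s hs

end Reconstruction

namespace OnlineAlgorithm

variable {U : Type*} (A : OnlineAlgorithm.{u} U)

/-- The transition kernel of the internal state for a sequence of updates, processed in order. -/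
noncomputable def steps : List (Update U) → Kernel A.State A.State
  | [] => Kernel.id
  | x :: T => steps T ∘ₖ A.step x

instance isMarkovKernel_steps (T : List (Update U)) : IsMarkovKernel (A.steps T) := by
  induction T with
  | nil => unfold steps; infer_instance
  | cons x T ih => unfold steps; infer_instance

lemma foldl_bind_step (T : List (Update U)) (μ : Measure A.State) :
    T.foldl (fun μ x => μ.bind (A.step x)) μ = A.steps T ∘ₘ μ := by
  induction T generalizing μ with
  | nil => simp [steps]
  | cons x T ih => rw [List.foldl_cons, ih, steps, ← Measure.comp_assoc]

instance isProbabilityMeasure_stateLaw (S : List (Update U)) :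
    IsProbabilityMeasure (A.stateLaw S) := by
  rw [stateLaw, foldl_bind_step]
  infer_instance

instance isProbabilityMeasure_law (S : List (Update U)) : IsProbabilityMeasure (A.law S) := by
  rw [law]
  infer_instance

lemma stateLaw_append (S T : List (Update U)) :
    A.stateLaw (S ++ T) = A.steps T ∘ₘ A.stateLaw S := by
  rw [stateLaw, List.foldl_append, foldl_bind_step, stateLaw]

lemma fst_law (S : List (Update U)) : (A.law S).fst = A.stateLaw S :=
  Measure.fst_compProd _ _

lemma snd_law_append (S T : List (Update U)) :
    (A.law (S ++ T)).snd = (A.output ∘ₖ A.steps T) ∘ₘ A.stateLaw S := by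
  rw [law, Measure.snd_compProd, stateLaw_append, Measure.comp_assoc]

variable {A}

lemma PanPrivate.stateLaw_real_le [DecidableEq U] {M : StreamModel} {ε : ℝ}
    (h : A.PanPrivate M ε) {S S' : List (Update U)} (hS : M.Admissible S) (hS' : M.Admissible S')
    (hN : Neighbors S S') {I : Set A.State} (hI : MeasurableSet I) :
    (A.stateLaw S).real I ≤ Real.exp ε * (A.stateLaw S').real I := by
  have hlaw := h S S' hS hS' hN I Set.univ hI .univ
  rw [Set.prod_univ, ← Measure.fst_apply hI, ← Measure.fst_apply hI, fst_law, fst_law] at hlaw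
  have hreal := ENNReal.toReal_mono (by finiteness) hlaw
  rwa [ENNReal.toReal_mul, ENNReal.toReal_ofReal (Real.exp_pos ε).le] at hreal

lemma EstimatesDistinctCount.mono [Fintype U] [DecidableEq U] {M : StreamModel} {α α' δ : ℝ}
    (h : A.EstimatesDistinctCount M α δ) (hα : α ≤ α') : A.EstimatesDistinctCount M α' δ :=
  fun S hS => (h S hS).trans (measureReal_mono fun _ hp => le_trans hp hα)

end OnlineAlgorithm

section Encoding

variable {U : Type*} {n : ℕ}

lemma StreamModel.admissible_of_nonneg (M : StreamModel) {S : List (Update U)}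
    (hS : ∀ x ∈ S, 0 ≤ x.2) : M.Admissible S := by
  cases M
  exacts [hS, trivial]

/-- The input that encodes the bit vector `z` by inserting, for each position `i`, the one of its
two IDs `e (i, false)` and `e (i, true)` that is selected by `z i`. -/
def encode (e : Fin n × Bool ↪ U) (z : Fin n → Bool) : List (Update U) :=
  List.ofFn fun i => (e (i, z i), 1)

lemma mem_encode {e : Fin n × Bool ↪ U} {z : Fin n → Bool} {x : Update U} :
    x ∈ encode e z ↔ ∃ i, (e (i, z i), 1) = x :=
  List.mem_ofFn' _ _

lemma eq_one_of_mem_encode {e : Fin n × Bool ↪ U} {z : Fin n → Bool} {x : Update U}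
    (hx : x ∈ encode e z) : x.2 = 1 := by
  obtain ⟨i, rfl⟩ := mem_encode.1 hx
  rfl

variable [DecidableEq U]

lemma stateVector_ofFn (f : Fin n → Update U) (l : U) :
    stateVector (List.ofFn f) l = ∑ i, if (f i).1 = l then (f i).2 else 0 := by
  rw [stateVector, Finset.sum_filter, ← (finCongr List.length_ofFn.symm).sum_comp]
  simp

lemma stateVector_ne_zero_iff {S : List (Update U)} (hS : ∀ x ∈ S, 0 < x.2) {l : U} :
    stateVector S l ≠ 0 ↔ ∃ x ∈ S, x.1 = l := by
  rw [stateVector, Ne, Finset.sum_eq_zero_iff_of_nonneg fun k _ => (hS _ (S.get_mem k)).le]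
  push Not
  simp only [Finset.mem_filter, Finset.mem_univ, true_and]
  constructor
  · rintro ⟨k, hk, -⟩
    exact ⟨S.get k, S.get_mem k, hk⟩
  · rintro ⟨x, hx, hxl⟩
    obtain ⟨k, rfl⟩ := List.mem_iff_get.1 hx
    exact ⟨k, hxl, (hS _ hx).ne'⟩

lemma sum_compl_singleton_eq_stateVector_sub (S : List (Update U)) (k : Fin S.length) (l : U) :
    ∑ k' ∈ {k}ᶜ with (S.get k').1 = l, (S.get k').2 =
      stateVector S l - if (S.get k).1 = l then (S.get k).2 else 0 := by
  rw [stateVector, Finset.sum_filter, Finset.sum_filter, Fintype.sum_eq_add_sum_compl k,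
    add_sub_cancel_left]

lemma neighbors_of_mem {S S' : List (Update U)} {i j : U} {d : ℤ} (hij : i ≠ j) (hi : (i, d) ∈ S)
    (hj : (j, d) ∈ S') (hrest : ∀ l, stateVector S l - (if i = l then d else 0) =
      stateVector S' l - (if j = l then d else 0)) : Neighbors S S' := by
  obtain ⟨k, hk⟩ := List.mem_iff_get.1 hi
  obtain ⟨k', hk'⟩ := List.mem_iff_get.1 hj
  refine ⟨i, j, hij, {k}, {k'}, ?_, ?_, ?_, fun l => ?_⟩
  · simp [-List.get_eq_getElem, hk]
  · simp [-List.get_eq_getElem, hk']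
  · simp [-List.get_eq_getElem, hk, hk']
  · rw [sum_compl_singleton_eq_stateVector_sub, sum_compl_singleton_eq_stateVector_sub, hk, hk',
      hrest]

lemma distinctCount_encode_append [Fintype U] (e : Fin n × Bool ↪ U) (z q : Fin n → Bool) :
    distinctCount (encode e z ++ encode e q) = n + hammingDist z q := by
  have hpos : ∀ x ∈ encode e z ++ encode e q, 0 < x.2 := fun x hx => by
    rcases List.mem_append.1 hx with h | h <;> simp [eq_one_of_mem_encode h]
  have hcard := card_filter_eq_or_eq z q
  rw [Fintype.card_fin, ← Finset.card_map e] at hcard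
  rw [← hcard, distinctCount]
  congr 1
  ext l
  simp only [Finset.mem_filter, Finset.mem_univ, true_and, stateVector_ne_zero_iff hpos,
    Finset.mem_map, List.mem_append, mem_encode]
  aesop

lemma neighbors_encode_flipBit (e : Fin n × Bool ↪ U) (z : Fin n → Bool) (i : Fin n) :
    Neighbors (encode e z) (encode e (flipBit z i)) := by
  refine neighbors_of_mem (i := e (i, z i)) (j := e (i, flipBit z i i)) (d := 1)
    (by simp [flipBit]) (mem_encode.2 ⟨i, rfl⟩) (mem_encode.2 ⟨i, rfl⟩) fun l => ?_
  rw [encode, encode, stateVector_ofFn, stateVector_ofFn, Fintype.sum_eq_add_sum_compl i,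
    Fintype.sum_eq_add_sum_compl i, add_sub_cancel_left, add_sub_cancel_left]
  refine Finset.sum_congr rfl fun k hk => ?_
  have hflip : flipBit z i k = z k := Function.update_of_ne (by simpa using hk) _ _
  simp only [hflip]

end Encoding

theorem OnlineAlgorithm.mul_le_of_estimatesDistinctCount_of_panPrivate {U : Type*} [Fintype U]
    [DecidableEq U] {A : OnlineAlgorithm.{u} U} {M : StreamModel} {a δ ε θ : ℝ} {n : ℕ}
    (hn : 2 * n ≤ Fintype.card U) (ha : 0 ≤ a) (hθ₀ : 0 < θ) (hθ : θ < 1 / 2)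
    (hA : A.EstimatesDistinctCount M a δ) (hP : A.PanPrivate M ε) :
    (1 - δ / θ) * n ≤ (Real.exp ε + 1) * ((2 * a + 1) / (1 - 2 * θ)) ^ 2 := by
  obtain ⟨e⟩ : Nonempty (Fin n × Bool ↪ U) :=
    Function.Embedding.nonempty_of_card_le (by simpa [mul_comm] using hn)
  have hadm : ∀ z, M.Admissible (encode e z) := fun z => M.admissible_of_nonneg fun x hx => by
    simp [eq_one_of_mem_encode hx]
  have hbound := mul_card_le_of_accurate_of_private (fun q => A.output ∘ₖ A.steps (encode e q))
    (μ := fun z => A.stateLaw (encode e z)) (b := n) (δ := δ) (Real.exp_pos ε).le ha hθ₀ hθ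
    (fun z q => ?_) fun z i I => hP.stateLaw_real_le (hadm z) (hadm _)
      (neighbors_encode_flipBit e z i)
  · simpa using hbound
  · have hacc := hA (encode e z ++ encode e q) <| M.admissible_of_nonneg fun x hx => by
      rcases List.mem_append.1 hx with h | h <;> simp [eq_one_of_mem_encode h]
    rw [distinctCount_encode_append, Nat.cast_add] at hacc
    rw [← snd_law_append, measureReal_def, Measure.snd_apply measurableSet_closedBall]
    exact hacc

lemma eventually_mul_sq_lt_mul_div_two {f : ℕ → ℝ} (hf : f =o[atTop] fun m : ℕ => √(m : ℝ))
    (B : ℝ) {p : ℝ} (hp : 0 < p) :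
    ∀ᶠ m : ℕ in atTop, B * f m ^ 2 < p * (m / 2 : ℕ) := by
  have hsq : (fun m => B * f m ^ 2) =o[atTop] fun m : ℕ => (m : ℝ) := by
    simpa using (hf.pow two_pos).const_mul_left B
  filter_upwards [hsq.bound (by positivity : 0 < p / 5), eventually_ge_atTop 2] with m hm hm2
  have hhalf : (m : ℝ) ≤ 4 * (m / 2 : ℕ) := by exact_mod_cast (by omega : m ≤ 4 * (m / 2))
  have hm0 : (0 : ℝ) < m := by positivity
  rw [Real.norm_natCast] at hm
  nlinarith [(le_abs_self _).trans hm, mul_pos hp hm0]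

lemma tendsto_sqrt_natCast_atTop : Tendsto (fun m : ℕ => √(m : ℝ)) atTop atTop :=
  Real.tendsto_sqrt_atTop.comp tendsto_natCast_atTop_atTop

lemma isLittleO_two_mul_abs_add_one {T : Type*} {l : Filter T} {f g : T → ℝ} (hf : f =o[l] g)
    (hg : Tendsto g l atTop) : (fun t => 2 * |f t| + 1) =o[l] g :=
  (hf.abs_left.const_mul_left 2).add <| (isLittleO_const_left_of_ne one_ne_zero).2 <|
    tendsto_norm_atTop_atTop.comp hg

lemma rhoStar_le_one : rhoStar ≤ 1 := measureReal_le_one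

end PanPrivacy

theorem mainTheorem8_general (M : PanPrivacy.StreamModel) (δ : ℝ) (hδ : δ < 1 / 2)
    (α : ℕ → ℝ) (hα : α =o[atTop] fun m : ℕ => √(m : ℝ)) (ε : ℝ) :
    ∀ᶠ m : ℕ in atTop, ∀ A : PanPrivacy.OnlineAlgorithm.{u} (Fin m),
      A.EstimatesDistinctCount M (α m) δ → ¬ A.PanPrivate M ε := by
  obtain ⟨θ, hmax, hθ⟩ := exists_between (max_lt hδ one_half_pos)
  obtain ⟨hδθ, hθ₀⟩ := max_lt_iff.1 hmax
  have hp : 0 < 1 - δ / θ := sub_pos.2 ((div_lt_one hθ₀).2 hδθ)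
  filter_upwards [PanPrivacy.eventually_mul_sq_lt_mul_div_two
    (PanPrivacy.isLittleO_two_mul_abs_add_one hα PanPrivacy.tendsto_sqrt_natCast_atTop)
    ((Real.exp ε + 1) / (1 - 2 * θ) ^ 2) hp]
    with m hm A hA hP
  have hbound := PanPrivacy.OnlineAlgorithm.mul_le_of_estimatesDistinctCount_of_panPrivate
    (n := m / 2) (by simpa using Nat.mul_div_le m 2) (abs_nonneg (α m)) hθ₀ hθ
    (hA.mono (le_abs_self _)) hP
  rw [div_pow, ← mul_div_assoc, mul_div_right_comm] at hbound
  exact hm.not_ge hbound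

theorem mainTheorem8 (M : PanPrivacy.StreamModel) (δ η : ℝ) (hη : 0 ≤ η)
    (hδ : δ < PanPrivacy.rhoStar / (6 * (1 + η)))
    (α : ℕ → ℝ) (hα : α =o[atTop] fun m : ℕ => √(m : ℝ)) (ε : ℝ) :
    ∀ᶠ m : ℕ in atTop, ∀ A : PanPrivacy.OnlineAlgorithm.{u} (Fin m),
      A.EstimatesDistinctCount M (α m) δ → ¬ A.PanPrivate M ε :=
  mainTheorem8_general M δ (hδ.trans_le
    (div_le_div₀ zero_le_one PanPrivacy.rhoStar_le_one two_pos (by linarith))) α hα ε
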